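/- Let $\mathbb{F}$ be a field of characteristic zero, and let $q\in\mathbb{F}$ be nonzero and not a root of unity. For $r,s\in\mathbb{F}$, let $\mathcal{U}_q(r,s)$ be the associative unital $\mathbb{F}$-algebra with generators $A,B$ and the single relation $AB-qBA=rA+sB$, regarded also as a Lie algebra with bracket $[X,Y]=XY-YX$, and let $\mathcal{L}_{(r,s)}$ be the Lie subalgebra of $\mathcal{U}_q(r,s)$ generated by $A$ and $B$. Then for every nonzero $s\in\mathbb{F}$, the Lie algebras $\mathcal{L}_{(s,0)}$ and $\mathcal{L}_{(0,s)}$ are isomorphic over $\mathbb{F}$. -/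

import Mathlib

/-- The two letters `A`, `B`. -/
inductive QEnvGen : Type
  | A
  | B

/-- The defining relation `AB = qBA + rA + sB` on the free algebra over `F` on the letters `A`, `B`. -/
inductive QEnvRel {F : Type*} [Field F] (q r s : F) :
    FreeAlgebra F QEnvGen → FreeAlgebra F QEnvGen → Prop
  | rel : QEnvRel q r s
      (FreeAlgebra.ι F QEnvGen.A * FreeAlgebra.ι F QEnvGen.B)
      (q • (FreeAlgebra.ι F QEnvGen.B * FreeAlgebra.ι F QEnvGen.A)
        + r • FreeAlgebra.ι F QEnvGen.A + s • FreeAlgebra.ι F QEnvGen.B)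

/-- The algebra `U_q(r, s)`: the associative unital `F`-algebra with generators `A`, `B` and the
single relation `AB - qBA = rA + sB`. -/
abbrev QEnv {F : Type*} [Field F] (q r s : F) : Type _ :=
  RingQuot (QEnvRel q r s)

/-- The Lie ring structure on `U_q(r, s)` given by the commutator `⁅X, Y⁆ = XY - YX`. -/
noncomputable instance QEnv.instLieRing {F : Type*} [Field F] (q r s : F) :
    LieRing (QEnv q r s) :=
  LieRing.ofAssociativeRing

noncomputable instance QEnv.instLieAlgebra {F : Type*} [Field F] (q r s : F) :
    LieAlgebra F (QEnv q r s) :=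
  LieAlgebra.ofAssociativeAlgebra

/-- The generator `A` of `U_q(r, s)`. -/
noncomputable def QEnv.genA {F : Type*} [Field F] (q r s : F) : QEnv q r s :=
  RingQuot.mkAlgHom F (QEnvRel q r s) (FreeAlgebra.ι F QEnvGen.A)

/-- The generator `B` of `U_q(r, s)`. -/
noncomputable def QEnv.genB {F : Type*} [Field F] (q r s : F) : QEnv q r s :=
  RingQuot.mkAlgHom F (QEnvRel q r s) (FreeAlgebra.ι F QEnvGen.B)

/-- The Lie subalgebra of `U_q(r, s)` generated by `A` and `B`, i.e. the Lie algebra of all Lie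
polynomials in `A` and `B`. -/
noncomputable def QEnv.lieGen {F : Type*} [Field F] (q r s : F) :
    LieSubalgebra F (QEnv q r s) :=
  LieSubalgebra.lieSpan F (QEnv q r s) {QEnv.genA q r s, QEnv.genB q r s}

namespace QEnv

/-! Reversing products while exchanging `A` and `B` fixes the shape of the relation and only swaps
`r` and `s`, so `swapOp` is an anti-isomorphism. The negative of an anti-isomorphism preserves
commutators; `negSwap` sends generators to negated generators, hence matches the generated Lie
subalgebras. -/

theorem neg_mul_neg_sub_neg_mul_neg {R : Type*} [Ring R] (a b : R) :
    -a * -b - -b * -a = a * b - b * a := by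
  rw [neg_mul_neg, neg_mul_neg]

variable {F : Type*} [Field F]

theorem genA_mul_genB (q r s : F) :
    genA q r s * genB q r s
      = q • (genB q r s * genA q r s) + r • genA q r s + s • genB q r s := by
  simpa [genA, genB] using RingQuot.mkAlgHom_rel F (QEnvRel.rel (q := q) (r := r) (s := s))

/-- The homomorphism `U_q(r, s) → U_q(s, r)ᵐᵒᵖ` exchanging the two generators. -/
noncomputable def swapOp (q r s : F) : QEnv q r s →ₐ[F] (QEnv q s r)ᵐᵒᵖ :=
  RingQuot.liftAlgHom F ⟨FreeAlgebra.lift F fun g => match g with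
    | .A => MulOpposite.op (genB q s r)
    | .B => MulOpposite.op (genA q s r), by
      rintro _ _ ⟨⟩
      simp only [map_mul, map_add, map_smul, FreeAlgebra.lift_ι_apply, ← MulOpposite.op_mul,
        ← MulOpposite.op_smul, ← MulOpposite.op_add, genA_mul_genB q s r]
      congr 1
      abel⟩

@[simp]
theorem swapOp_genA (q r s : F) :
    swapOp q r s (genA q r s) = MulOpposite.op (genB q s r) := by
  simp [swapOp, genA]

@[simp]
theorem swapOp_genB (q r s : F) :
    swapOp q r s (genB q r s) = MulOpposite.op (genA q s r) := by
  simp [swapOp, genB]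

theorem unop_swapOp_unop_swapOp (q r s : F) (x : QEnv q r s) :
    (swapOp q s r (swapOp q r s x).unop).unop = x := by
  have h : ((AlgEquiv.opOp F (QEnv q r s)).symm.toAlgHom.comp
      ((AlgHom.op (swapOp q s r)).comp (swapOp q r s))) = AlgHom.id F (QEnv q r s) := by
    apply RingQuot.ringQuot_ext'
    apply FreeAlgebra.hom_ext
    funext g
    cases g
    · change (swapOp q s r (swapOp q r s (genA q r s)).unop).unop = genA q r s
      simp
    · change (swapOp q s r (swapOp q r s (genB q r s)).unop).unop = genB q r s
      simp
  exact DFunLike.congr_fun h x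

/-- The negative of the anti-isomorphism exchanging the generators, as an isomorphism of
Lie algebras. -/
noncomputable def negSwap (q r s : F) : QEnv q r s ≃ₗ⁅F⁆ QEnv q s r where
  toFun x := -(swapOp q r s x).unop
  invFun x := -(swapOp q s r x).unop
  map_add' x y := by simp [add_comm]
  map_smul' c x := by simp
  map_lie' {x y} := by
    change -(swapOp q r s (x * y - y * x)).unop
      = -(swapOp q r s x).unop * -(swapOp q r s y).unop
        - -(swapOp q r s y).unop * -(swapOp q r s x).unop
    -- Reversal flips the sign of the commutator and the outer minus restores it; the paired signs
    -- on the right cancel.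
    refine Eq.trans ?_ (neg_mul_neg_sub_neg_mul_neg _ _).symm
    simp
  left_inv x := by simp [unop_swapOp_unop_swapOp]
  right_inv x := by simp [unop_swapOp_unop_swapOp]

theorem negSwap_genA (q r s : F) : negSwap q r s (genA q r s) = -genB q s r := by
  change -(swapOp q r s (genA q r s)).unop = _
  simp

theorem negSwap_genB (q r s : F) : negSwap q r s (genB q r s) = -genA q s r := by
  change -(swapOp q r s (genB q r s)).unop = _
  simp

theorem genA_mem_lieGen (q r s : F) : genA q r s ∈ lieGen q r s :=
  LieSubalgebra.subset_lieSpan (by simp)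

theorem genB_mem_lieGen (q r s : F) : genB q r s ∈ lieGen q r s :=
  LieSubalgebra.subset_lieSpan (by simp)

theorem lieGen_le_comap_negSwap (q r s : F) :
    lieGen q r s ≤ (lieGen q s r).comap (negSwap q r s).toLieHom := by
  refine LieSubalgebra.lieSpan_le.mpr ?_
  rintro x (rfl | rfl)
  · change negSwap q r s (genA q r s) ∈ lieGen q s r
    rw [negSwap_genA]
    exact neg_mem (genB_mem_lieGen q s r)
  · change negSwap q r s (genB q r s) ∈ lieGen q s r
    rw [negSwap_genB]
    exact neg_mem (genA_mem_lieGen q s r)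

theorem map_negSwap_lieGen (q r s : F) :
    (lieGen q r s).map (negSwap q r s).toLieHom = lieGen q s r := by
  apply le_antisymm
  · rintro _ ⟨x, hx, rfl⟩
    exact lieGen_le_comap_negSwap q r s hx
  · intro y hy
    -- The inverse of `negSwap q r s` is `negSwap q s r`, so the same inclusion with `r`, `s`
    -- swapped gives surjectivity.
    exact ⟨negSwap q s r y, lieGen_le_comap_negSwap q s r hy, (negSwap q r s).right_inv y⟩

end QEnv

theorem corollary6 {F : Type*} [Field F] [CharZero F] (q s : F)
    (hq0 : q ≠ 0) (hq : ∀ n : ℕ, 0 < n → q ^ n ≠ 1) (hs : s ≠ 0) :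
    Nonempty (QEnv.lieGen q s 0 ≃ₗ⁅F⁆ QEnv.lieGen q 0 s) :=
  ⟨LieEquiv.ofSubalgebras _ _ (QEnv.negSwap q s 0) (QEnv.map_negSwap_lieGen q s 0)⟩
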